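/- Let $V$ be a finite-dimensional real vector space with a positive definite inner product $\langle\cdot,\cdot\rangle$ and Euclidean norm $\|v\|_2=\sqrt{\langle v,v\rangle}$. Let $\|\cdot\|_X$ be a norm on $V$ and let $\|v\|_Y=\max\{\langle v,w\rangle : w\in V,\ \|w\|_X=1\}$ be its dual norm (for $V=\{0\}$, $\|\cdot\|_Y$ is the zero function). For norms $N_1,N_2$ on $V$, an identity $c=a+b$ is called an $N_1N_2$-decomposition of $c$ if for every $a',b'\in V$ with $c=a'+b'$ we have $N_1(a')>N_1(a)$, or $N_2(b')>N_2(b)$, or $(N_1(a'),N_2(b'))=(N_1(a),N_2(b))$. A vector $c\in V$ is tight if every $X2$-decomposition of $c$ (that is, with $N_1=\|\cdot\|_X$, $N_2=\|\cdot\|_2$) is also an $XY$-decomposition of $c$ (with $N_1=\|\cdot\|_X$, $N_2=\|\cdot\|_Y$), and the norm $\|\cdot\|_X$ is tight if every vector of $V$ is tight. A vector $u\in V$ is unitangent if $\|u\|_2^2=\|u\|_X\|u\|_Y$. A face of the unit ball $B_X=\{v\in V : \|v\|_X\le 1\}$ is a closed convex subset $F\subseteq B_X$ such that whenever $a,b\in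 B_X$, $0<t<1$ and $ta+(1-t)b\in F$, then $a,b\in F$. A vector $u$ is perpendicular to $F$ if $\langle u,v-w\rangle=0$ for all $v,w\in F$. Then $\|\cdot\|_X$ is tight if and only if every nonempty face $F$ of $B_X$ contains a unitangent vector that is perpendicular to $F$. -/

import Mathlib

namespace TightNorm

/-- The pair `(x, y)` is Pareto efficient for `c` with respect to the norms `N₁`, `N₂`. -/
def ParetoEfficient {V : Type*} [AddCommGroup V] (N₁ N₂ : V → ℝ) (c : V) (x y : ℝ) : Prop :=
  ∃ a b : V, c = a + b ∧ N₁ a = x ∧ N₂ b = y ∧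
    ∀ a' b' : V, c = a' + b' → x < N₁ a' ∨ y < N₂ b' ∨ (N₁ a' = x ∧ N₂ b' = y)

/-- `c = a + b` is an `N₁N₂`-decomposition. -/
def IsDecomposition {V : Type*} [AddCommGroup V] (N₁ N₂ : V → ℝ) (c a b : V) : Prop :=
  c = a + b ∧ ParetoEfficient N₁ N₂ c (N₁ a) (N₂ b)

/-- The norm dual to `X` with respect to the inner product of `V`: the maximum of `⟨v, w⟩` over
the unit sphere of `X`. On the zero space the sphere is empty and the value is `0`, as it should
be. -/
noncomputable def dualNorm {V : Type*} [NormedAddCommGroup V] [InnerProductSpace ℝ V]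
    (X : Seminorm ℝ V) (v : V) : ℝ :=
  sSup ((fun w : V => inner ℝ v w) '' {w : V | X w = 1})

/-- A vector `c` is tight (for `X`, with dual norm `Y`): every `X2`-decomposition of `c` is
an `XY`-decomposition. Here `2` is the Euclidean norm `‖v‖ = √⟨v, v⟩` of `V`. -/
def IsTight {V : Type*} [NormedAddCommGroup V] [InnerProductSpace ℝ V]
    (X : Seminorm ℝ V) (c : V) : Prop :=
  ∀ a b : V, IsDecomposition X (fun v => ‖v‖) c a b → IsDecomposition X (dualNorm X) c a b

/-- A norm is tight if every vector is tight. -/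
def IsTightNorm {V : Type*} [NormedAddCommGroup V] [InnerProductSpace ℝ V]
    (X : Seminorm ℝ V) : Prop :=
  ∀ c : V, IsTight X c

/-- A vector `u` is unitangent if `‖u‖₂² = ‖u‖_X ‖u‖_Y`. -/
def IsUnitangent {V : Type*} [NormedAddCommGroup V] [InnerProductSpace ℝ V]
    (X : Seminorm ℝ V) (u : V) : Prop :=
  ‖u‖ ^ 2 = X u * dualNorm X u

/-- The closed unit ball of `X`. -/
def unitBall {V : Type*} [AddCommGroup V] [Module ℝ V] (X : Seminorm ℝ V) : Set V :=
  {v : V | X v ≤ 1}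

/-- A face of a set `B` (meant for `B` closed and convex; the empty set is not excluded here). -/
def IsFace {V : Type*} [AddCommGroup V] [Module ℝ V] [TopologicalSpace V] (B F : Set V) : Prop :=
  F ⊆ B ∧ Convex ℝ F ∧ IsClosed F ∧
    ∀ a ∈ B, ∀ b ∈ B, ∀ t : ℝ, 0 < t → t < 1 → t • a + (1 - t) • b ∈ F → a ∈ F ∧ b ∈ F

/-- `u` is perpendicular to `F`: it is orthogonal to the directions of the affine hull of `F`,
that is, `⟨u, ·⟩` is constant on `F`. -/
def PerpTo {V : Type*} [NormedAddCommGroup V] [InnerProductSpace ℝ V] (u : V) (F : Set V) : Prop :=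
  ∀ v ∈ F, ∀ w ∈ F, inner ℝ u (v - w) = 0

end TightNorm

/-!
Write `B` for the unit ball of `X`, `Y` for the dual norm, and say that `b` is normal to `B` at `a`
if `⟪b, ·⟫` attains its maximum over `B` at `a`. By the variational inequality for the metric
projection, `c = a + b` is an `X2`-decomposition exactly when `⟪b, ·⟫` attains its maximum over
`{v | X v ≤ X a}` at `a`. On the other hand, an `XY`-decomposition with `X a = 1` and `b ≠ 0` is
witnessed by a Lagrange multiplier: a vector `w` with `X w = 1`, at which `⟪b, ·⟫` is maximal over
`B`, and which is itself normal to `B` at `a` (`exists_multiplier`).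

If every face has a unitangent perpendicular vector `u`, apply this to the face of `B` exposed by
`b`: then `⟪u, a⟫ = X a * Y u` and `⟪b, u⟫ = Y b`, so `u` is a multiplier and certifies the
`XY`-decomposition (`isTight_of_faces`).

Conversely, let `X` be tight and let `F` be a face; if `0 ∈ F`, then `u = 0` will do. Otherwise
choose `a` in the relative interior of `F`. The face `F` need not be exposed, but it is nearly so
(`IsFace.exists_almost_exposing`): for every compact convex `K ⊆ B \ F` there are `a'` arbitrarily
close to `a` and `b` normal to `B` at
`a'` with `⟪b, ·⟫ < ⟪b, a'⟫` on `K`. This follows from the separation of the sets `a - K` and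
`η⁻¹ (B - a)`, which are disjoint because `F` is a face, followed by a projection onto `B`.
Tightness of `a' + b` gives a multiplier `w`, which is normal to `B` at `a'` and avoids `K`. Letting
`K` exhaust `B \ F`, a limit point `u` of the multipliers lies in `F` and is normal to `B` at `a`.
As `a` is in the relative interior, `⟪u, ·⟫` is constant on `F`, so that
`Y u = ⟪u, a⟫ = ⟪u, u⟫`.
-/

open Set Filter Topology
open scoped RealInnerProductSpace

namespace TightNorm

variable {V : Type*} [NormedAddCommGroup V] [InnerProductSpace ℝ V]

/-! ### The unit ball, its metric projection and the dual norm -/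

lemma convex_unitBall (X : Seminorm ℝ V) : Convex ℝ (unitBall X) := by
  have h : unitBall X = X.closedBall 0 1 := by ext v; simp [unitBall, Seminorm.mem_closedBall]
  rw [h]
  exact X.convex_closedBall 0 1

lemma zero_mem_unitBall (X : Seminorm ℝ V) : (0 : V) ∈ unitBall X := by simp [unitBall]

lemma continuous_seminorm [FiniteDimensional ℝ V] (X : Seminorm ℝ V) : Continuous X :=
  continuousOn_univ.1 (X.convexOn.continuousOn isOpen_univ)

lemma isCompact_unitBall [FiniteDimensional ℝ V] (X : Seminorm ℝ V)
    (hX : ∀ v : V, X v = 0 → v = 0) : IsCompact (unitBall X) := by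
  refine Metric.isCompact_of_isClosed_isBounded
    (isClosed_le (continuous_seminorm X) continuous_const) ?_
  rcases (Metric.sphere (0 : V) 1).eq_empty_or_nonempty with h | h
  · have hz : ∀ v : V, v = 0 := by
      intro v
      by_contra hv
      have : (‖v‖⁻¹ : ℝ) • v ∈ Metric.sphere (0 : V) 1 := by
        simp [norm_smul, inv_mul_cancel₀ (norm_ne_zero_iff.2 hv)]
      simp [h] at this
    refine (Metric.isBounded_closedBall (x := (0 : V)) (r := 0)).subset fun v _ => ?_
    simp [hz v]
  · obtain ⟨e, he, hmin⟩ := (isCompact_sphere (0 : V) 1).exists_isMinOn h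
      (continuous_seminorm X).continuousOn
    have he1 : ‖e‖ = 1 := by simpa using he
    have hpos : 0 < X e := by
      refine lt_of_le_of_ne (apply_nonneg X e) fun h0 => ?_
      rw [hX e h0.symm] at he1
      simp at he1
    refine (Metric.isBounded_closedBall (x := (0 : V)) (r := (X e)⁻¹)).subset fun v hv => ?_
    rw [mem_closedBall_zero_iff]
    by_cases hv0 : v = 0
    · simp [hv0, hpos.le]
    have hn : 0 < ‖v‖ := norm_pos_iff.2 hv0
    have h1 : X e ≤ X ((‖v‖⁻¹ : ℝ) • v) := hmin (by
      simp [norm_smul, inv_mul_cancel₀ hn.ne'])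
    rw [map_smul_eq_mul, Real.norm_of_nonneg (inv_nonneg.2 hn.le), inv_mul_eq_div,
      le_div_iff₀ hn] at h1
    have h2 : X v ≤ 1 := hv
    rw [inv_eq_one_div, le_div_iff₀ hpos]
    linarith

lemma seminorm_pos {X : Seminorm ℝ V} (hX : ∀ v : V, X v = 0 → v = 0) {v : V} (hv : v ≠ 0) :
    0 < X v :=
  lt_of_le_of_ne (apply_nonneg X v) fun h => hv (hX v h.symm)

lemma seminorm_normalize {X : Seminorm ℝ V} {v : V} (hv : 0 < X v) : X ((X v)⁻¹ • v) = 1 := by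
  rw [map_smul_eq_mul, Real.norm_of_nonneg (inv_nonneg.2 hv.le), inv_mul_cancel₀ hv.ne']

lemma dualNorm_le {X : Seminorm ℝ V} {v : V} {M : ℝ} (hM : 0 ≤ M)
    (h : ∀ w ∈ unitBall X, ⟪v, w⟫ ≤ M) : dualNorm X v ≤ M := by
  refine Real.sSup_le ?_ hM
  rintro _ ⟨w, hw, rfl⟩
  exact h w (le_of_eq hw)

@[simp] lemma dualNorm_zero (X : Seminorm ℝ V) : dualNorm X 0 = 0 := by
  refine le_antisymm (dualNorm_le le_rfl (by simp)) (Real.sSup_nonneg ?_)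
  rintro _ ⟨w, -, rfl⟩
  simp

/-- An `X2`-decomposition satisfies the variational inequality of the metric projection onto
`{v | X v ≤ X a}`. -/
lemma inner_le_of_isDecomposition {X : Seminorm ℝ V} {c a b : V}
    (h : IsDecomposition X (fun v => ‖v‖) c a b)
    {v : V} (hv : X v ≤ X a) : ⟪b, v⟫ ≤ ⟪b, a⟫ := by
  obtain ⟨rfl, a₀, b₀, -, -, -, hP⟩ := h
  have hK : Convex ℝ {v | X v ≤ X a} := by
    simpa using X.convexOn.convex_le (X a)
  have key := (norm_eq_iInf_iff_real_inner_le_zero hK (u := a + b) (v := a) (le_refl (X a))).1 (by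
    have : Nonempty {v | X v ≤ X a} := ⟨⟨a, le_refl (X a)⟩⟩
    refine le_antisymm (le_ciInf fun w => ?_)
      (ciInf_le (f := fun w : {v | X v ≤ X a} => ‖a + b - w‖)
        ⟨0, by rintro _ ⟨w, rfl⟩; exact norm_nonneg _⟩ ⟨a, le_refl (X a)⟩)
    have hw : X (w : V) ≤ X a := w.2
    rcases hP w (a + b - w) (by abel) with h1 | h1 | h1
    · exact absurd hw (not_le.2 h1)
    · simpa using h1.le
    · simpa using h1.2.ge) v hv
  rw [add_sub_cancel_left, inner_sub_right] at key
  linarith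

/-- The converse: the variational inequality characterises `X2`-decompositions. -/
lemma isDecomposition_of_inner_le {X : Seminorm ℝ V} {a b : V}
    (h : ∀ v, X v ≤ X a → ⟪b, v⟫ ≤ ⟪b, a⟫) :
    IsDecomposition X (fun v => ‖v‖) (a + b) a b := by
  refine ⟨rfl, a, b, rfl, rfl, rfl, fun a' b' hab => ?_⟩
  by_contra! hcon
  obtain ⟨h1, h2, h3⟩ := hcon
  have hb' : b' = b + (a - a') := by
    rw [← add_sub_assoc, add_comm b a, hab]; abel
  have hn : ‖b'‖ ^ 2 = ‖b‖ ^ 2 + 2 * ⟪b, a - a'⟫ + ‖a - a'‖ ^ 2 := by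
    rw [hb', norm_add_sq_real]
  have h4 := h a' h1
  rw [inner_sub_right] at hn
  have h5 : ‖b'‖ ^ 2 ≤ ‖b‖ ^ 2 := pow_le_pow_left₀ (norm_nonneg _) h2 2
  have h6 : ‖a - a'‖ = 0 := by nlinarith [sq_nonneg ‖a - a'‖]
  have h7 : a = a' := sub_eq_zero.1 (norm_eq_zero.1 h6)
  subst h7
  exact h3 rfl (by simp [hb'])

section Dual

variable [FiniteDimensional ℝ V] {X : Seminorm ℝ V}

/-- The Cauchy–Schwarz inequality for a norm and its dual. -/
lemma inner_le_dualNorm_mul (hX : ∀ v : V, X v = 0 → v = 0) (v w : V) :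
    ⟪v, w⟫ ≤ dualNorm X v * X w := by
  by_cases hw : w = 0
  · simp [hw]
  have hpos := seminorm_pos hX hw
  have hb : BddAbove ((fun w : V => ⟪v, w⟫) '' {w : V | X w = 1}) :=
    ((isCompact_unitBall X hX).bddAbove_image (f := fun w : V => ⟪v, w⟫)
      (by fun_prop)).mono (image_mono fun w hw => le_of_eq hw)
  have h := le_csSup hb ⟨(X w)⁻¹ • w, seminorm_normalize hpos, rfl⟩
  change ⟪v, (X w)⁻¹ • w⟫ ≤ dualNorm X v at h
  rwa [inner_smul_right, inv_mul_eq_div, div_le_iff₀ hpos] at h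

lemma dualNorm_nonneg (hX : ∀ v : V, X v = 0 → v = 0) (v : V) : 0 ≤ dualNorm X v := by
  by_cases hv : v = 0
  · simp [hv]
  have h := inner_le_dualNorm_mul hX v v
  exact le_of_mul_le_mul_right (by simpa using real_inner_self_nonneg.trans h) (seminorm_pos hX hv)

lemma dualNorm_pos (hX : ∀ v : V, X v = 0 → v = 0) {v : V} (hv : v ≠ 0) : 0 < dualNorm X v := by
  have h := inner_le_dualNorm_mul hX v v
  exact pos_of_mul_pos_left ((real_inner_self_pos.2 hv).trans_le h) (apply_nonneg X v)

lemma inner_le_dualNorm (hX : ∀ v : V, X v = 0 → v = 0) (v : V) {w : V} (hw : w ∈ unitBall X) :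
    ⟪v, w⟫ ≤ dualNorm X v :=
  (inner_le_dualNorm_mul hX v w).trans (mul_le_of_le_one_right (dualNorm_nonneg hX v) hw)

/-- Biduality: the value of `X` at `w` is attained by a vector of dual norm at most one. -/
lemma exists_dualNorm_le_one_inner_eq (w : V) :
    ∃ y : V, (∀ v ∈ unitBall X, ⟪y, v⟫ ≤ 1) ∧ X w ≤ ⟪y, w⟫ := by
  rcases (apply_nonneg X w).eq_or_lt with h0 | hpos
  · exact ⟨0, by simp, by simp [← h0]⟩
  obtain ⟨f, hf⟩ := geometric_hahn_banach_open_point (s := X.ball 0 (X w)) (x := w)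
    (X.convex_ball 0 (X w)) (by
      have : X.ball 0 (X w) = {v | X v < X w} := by ext v; simp [Seminorm.mem_ball]
      rw [this]
      exact isOpen_lt (continuous_seminorm X) continuous_const) (by simp [Seminorm.mem_ball])
  have hfw : 0 < f w := by
    simpa using hf 0 (by simpa [Seminorm.mem_ball] using hpos)
  refine ⟨(X w / f w) • (InnerProductSpace.toDual ℝ V).symm f, fun v hv => ?_, ?_⟩
  · rw [real_inner_smul_left, InnerProductSpace.toDual_symm_apply, div_mul_eq_mul_div,
      div_le_one hfw]
    -- `X w • v` is the limit of the vectors `t • v`, `t → X w`, of the open ball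
    have hlim : Tendsto (fun t : ℝ => t * f v) (𝓝[<] X w) (𝓝 (X w * f v)) :=
      Tendsto.mono_left (Continuous.tendsto (by fun_prop) (X w)) nhdsWithin_le_nhds
    refine le_of_tendsto hlim ?_
    filter_upwards [Ioo_mem_nhdsLT hpos] with t ht
    have hv' : X v ≤ 1 := hv
    have h := hf (t • v) (by
      rw [Seminorm.mem_ball, sub_zero, map_smul_eq_mul, Real.norm_of_nonneg ht.1.le]
      nlinarith [ht.1, ht.2])
    rw [map_smul, smul_eq_mul] at h
    exact h.le
  · rw [real_inner_smul_left, InnerProductSpace.toDual_symm_apply, div_mul_cancel₀ _ hfw.ne']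

/-! ### Multipliers of `XY`-decompositions -/

/-- The Lagrange multiplier of an `XY`-decomposition, obtained by separating the open ball
`{v | X v < X a}` from the convex set of all `v` for which `c - v` has dual norm at most that
of `b`. -/
lemma exists_multiplier (hX : ∀ v : V, X v = 0 → v = 0) {c a b : V}
    (h : IsDecomposition X (dualNorm X) c a b) (ha : X a = 1) (hb : b ≠ 0) :
    ∃ w : V, X w = 1 ∧ dualNorm X b ≤ ⟪b, w⟫ ∧ ∀ v ∈ unitBall X, ⟪w, v⟫ ≤ ⟪w, a⟫ := by
  obtain ⟨rfl, a₀, b₀, -, -, -, hP⟩ := h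
  have hYb := dualNorm_pos hX hb
  obtain ⟨f, r, hf1, hf2⟩ := geometric_hahn_banach_open (s := {v : V | X v < 1})
    (t := {v : V | ∀ z ∈ unitBall X, ⟪a + b - v, z⟫ ≤ dualNorm X b})
    (by simpa using X.convexOn.convex_lt 1)
    (isOpen_lt (continuous_seminorm X) continuous_const)
    (by
      intro x hx y hy s t hs ht hst z hz
      have h1 := hx z hz
      have h2 := hy z hz
      have h3 : a + b - (s • x + t • y) = s • (a + b - x) + t • (a + b - y) := by
        have : a + b = s • (a + b) + t • (a + b) := by rw [← add_smul, hst, one_smul]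
        nth_rewrite 1 [this]
        module
      rw [h3, inner_add_left, real_inner_smul_left, real_inner_smul_left]
      calc s * ⟪a + b - x, z⟫ + t * ⟪a + b - y, z⟫
          ≤ s * dualNorm X b + t * dualNorm X b := by gcongr
        _ = dualNorm X b := by rw [← add_mul, hst, one_mul])
    (by
      rw [Set.disjoint_left]
      intro v hv1 hv2
      have hv1' : X v < 1 := hv1
      have hY : dualNorm X (a + b - v) ≤ dualNorm X b := dualNorm_le hYb.le hv2
      rcases hP v (a + b - v) (by abel) with h1 | h1 | h1
      · linarith
      · linarith
      · linarith [h1.1])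
  set w := (InnerProductSpace.toDual ℝ V).symm f with hw
  have hfw : ∀ v, f v = ⟪w, v⟫ := fun v => (InnerProductSpace.toDual_symm_apply).symm
  have hat : r ≤ ⟪w, a⟫ := by
    rw [← hfw]
    exact hf2 a fun z hz => by
      rw [add_sub_cancel_left]
      exact inner_le_dualNorm hX b hz
  have hball : ∀ v ∈ unitBall X, ⟪w, v⟫ ≤ r := by
    intro v hv
    -- `v` is the limit of the vectors `t • v`, `t → 1`, of the open ball
    have hlim : Tendsto (fun t : ℝ => ⟪w, t • v⟫) (𝓝[<] 1) (𝓝 ⟪w, (1 : ℝ) • v⟫) :=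
      Tendsto.mono_left (Continuous.tendsto (by fun_prop) 1) nhdsWithin_le_nhds
    rw [one_smul] at hlim
    refine le_of_tendsto hlim ?_
    filter_upwards [Ioo_mem_nhdsLT (zero_lt_one (α := ℝ))] with t ht
    rw [← hfw]
    refine (hf1 _ ?_).le
    have hv' : X v ≤ 1 := hv
    change X (t • v) < 1
    rw [map_smul_eq_mul, Real.norm_of_nonneg ht.1.le]
    nlinarith [ht.1, ht.2]
  have hw0 : w ≠ 0 := by
    intro h0
    have h1 := hf1 0 (by simp)
    rw [hfw, h0, inner_zero_left] at h1
    rw [h0, inner_zero_left] at hat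
    linarith
  have hpos := seminorm_pos hX hw0
  -- `⟪w, ·⟫` is maximal at `b` among the vectors whose dual norm is at most that of `b`
  have hwb : dualNorm X b * X w ≤ ⟪b, w⟫ := by
    obtain ⟨y, hy1, hy2⟩ := exists_dualNorm_le_one_inner_eq (X := X) w
    have h1 := hf2 (a + b - dualNorm X b • y) fun z hz => by
      rw [sub_sub_cancel, real_inner_smul_left]
      exact mul_le_of_le_one_right hYb.le (hy1 z hz)
    rw [hfw, inner_sub_right, inner_add_right, real_inner_smul_right, real_inner_comm,
      real_inner_comm b w, real_inner_comm y w] at h1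
    have h2 : ⟪a, w⟫ ≤ r := by
      rw [real_inner_comm]; exact hball a (le_of_eq ha)
    have h3 := mul_le_mul_of_nonneg_left hy2 hYb.le
    linarith
  refine ⟨(X w)⁻¹ • w, seminorm_normalize hpos, ?_, fun v hv => ?_⟩
  · rw [real_inner_smul_right, inv_mul_eq_div, le_div_iff₀ hpos]
    exact hwb
  · rw [real_inner_smul_left, real_inner_smul_left]
    exact mul_le_mul_of_nonneg_left ((hball v hv).trans hat) (inv_nonneg.2 hpos.le)

/-! ### Unitangent vectors in faces imply tightness -/

/-- A vector `u` at which both terms of `c = a + b` attain the Cauchy–Schwarz bound certifies an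
`XY`-decomposition. -/
lemma isDecomposition_of_certificate (hX : ∀ v : V, X v = 0 → v = 0) {a b u : V} (hu : X u = 1)
    (h1 : X a * dualNorm X u ≤ ⟪a, u⟫) (h2 : dualNorm X b ≤ ⟪b, u⟫) :
    IsDecomposition X (dualNorm X) (a + b) a b := by
  have hu0 : u ≠ 0 := by rintro rfl; simp at hu
  have hY := dualNorm_pos hX hu0
  refine ⟨rfl, a, b, rfl, rfl, rfl, fun a' b' hab => ?_⟩
  by_contra! hcon
  obtain ⟨h3, h4, h5⟩ := hcon
  have e : ⟪a, u⟫ + ⟪b, u⟫ = ⟪a', u⟫ + ⟪b', u⟫ := by rw [← inner_add_left, hab, inner_add_left]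
  have i1 : ⟪a', u⟫ ≤ X a' * dualNorm X u := by
    rw [real_inner_comm, mul_comm]; exact inner_le_dualNorm_mul hX u a'
  have i2 : ⟪b', u⟫ ≤ dualNorm X b' := inner_le_dualNorm hX b' hu.le
  have h6 : X a' = X a := le_antisymm h3 (le_of_mul_le_mul_right (by linarith) hY)
  refine h5 h6 (le_antisymm h4 ?_)
  rw [h6] at i1
  linarith

/-- The face exposed by `b`. -/
lemma isFace_exposed (X : Seminorm ℝ V) (b : V) :
    IsFace (unitBall X) {v | v ∈ unitBall X ∧ ∀ z ∈ unitBall X, ⟪b, z⟫ ≤ ⟪b, v⟫} := by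
  refine ⟨fun v hv => hv.1, ?_, ?_, ?_⟩
  · intro x hx y hy s t hs ht hst
    refine ⟨convex_unitBall X hx.1 hy.1 hs ht hst, fun z hz => ?_⟩
    rw [inner_add_right, real_inner_smul_right, real_inner_smul_right]
    calc ⟪b, z⟫ = s * ⟪b, z⟫ + t * ⟪b, z⟫ := by rw [← add_mul, hst, one_mul]
      _ ≤ s * ⟪b, x⟫ + t * ⟪b, y⟫ := by
        gcongr
        · exact hx.2 z hz
        · exact hy.2 z hz
  · have : {v | v ∈ unitBall X ∧ ∀ z ∈ unitBall X, ⟪b, z⟫ ≤ ⟪b, v⟫} =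
        unitBall X ∩ ⋂ z ∈ unitBall X, {v | ⟪b, z⟫ ≤ ⟪b, v⟫} := by
      ext v; simp
    rw [this]
    exact (isClosed_le (continuous_seminorm X) continuous_const).inter
      (isClosed_biInter fun z _ => isClosed_le continuous_const (by fun_prop))
  · intro x hx y hy t ht0 ht1 hxy
    have h := hxy.2
    simp only [inner_add_right, real_inner_smul_right] at h
    refine ⟨⟨hx, fun z hz => ?_⟩, ⟨hy, fun z hz => ?_⟩⟩
    · have h1 := h y hy
      have h2 := h z hz
      have h3 : ⟪b, y⟫ ≤ ⟪b, x⟫ := by nlinarith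
      nlinarith
    · have h1 := h x hx
      have h2 := h z hz
      have h3 : ⟪b, x⟫ ≤ ⟪b, y⟫ := by nlinarith
      nlinarith

lemma isTight_of_faces (hX : ∀ v : V, X v = 0 → v = 0)
    (h : ∀ F : Set V, IsFace (unitBall X) F → F.Nonempty →
      ∃ u ∈ F, IsUnitangent X u ∧ PerpTo u F) : IsTightNorm X := by
  intro c a b hab
  have hvar : ∀ v, X v ≤ X a → ⟪b, v⟫ ≤ ⟪b, a⟫ := fun v hv => inner_le_of_isDecomposition hab hv
  obtain ⟨rfl, -⟩ := hab
  by_cases hb : b = 0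
  · subst hb
    refine ⟨rfl, a, 0, rfl, rfl, rfl, fun a' b' hab => ?_⟩
    by_cases hb' : b' = 0
    · subst hb'
      exact Or.inr (Or.inr ⟨by rw [add_zero, add_zero] at hab; rw [hab], rfl⟩)
    · exact Or.inr (Or.inl (by simpa using dualNorm_pos hX hb'))
  by_cases ha : a = 0
  · subst ha
    refine ⟨rfl, 0, b, rfl, rfl, rfl, fun a' b' hab => ?_⟩
    by_cases ha' : a' = 0
    · subst ha'
      exact Or.inr (Or.inr ⟨rfl, by rw [zero_add, zero_add] at hab; rw [hab]⟩)
    · exact Or.inl (by simpa using seminorm_pos hX ha')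
  have hXa := seminorm_pos hX ha
  have hXb := seminorm_pos hX hb
  have hmem : (X a)⁻¹ • a ∈ {v | v ∈ unitBall X ∧ ∀ z ∈ unitBall X, ⟪b, z⟫ ≤ ⟪b, v⟫} := by
    refine ⟨(seminorm_normalize hXa).le, fun z hz => ?_⟩
    have hz' : X z ≤ 1 := hz
    have h1 := hvar (X a • z) (by
      rw [map_smul_eq_mul, Real.norm_of_nonneg hXa.le]
      exact mul_le_of_le_one_right hXa.le hz')
    rw [real_inner_smul_right] at h1
    rw [real_inner_smul_right, inv_mul_eq_div, le_div_iff₀ hXa]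
    linarith
  obtain ⟨u, ⟨huB, humax⟩, hut, hperp⟩ := h _ (isFace_exposed X b) ⟨_, hmem⟩
  have hbu : dualNorm X b ≤ ⟪b, u⟫ :=
    dualNorm_le (by simpa using humax 0 (zero_mem_unitBall X)) humax
  have huB' : X u ≤ 1 := huB
  have hu1 : X u = 1 := by
    have h1 := inner_le_dualNorm_mul hX b u
    exact le_antisymm huB' (le_of_mul_le_mul_left (by linarith) (dualNorm_pos hX hb))
  refine isDecomposition_of_certificate hX hu1 ?_ hbu
  have h2 := hperp _ hmem u ⟨huB, humax⟩
  have h3 : ‖u‖ ^ 2 = X u * dualNorm X u := hut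
  rw [inner_sub_right, real_inner_smul_right, real_inner_self_eq_norm_sq, h3, hu1, one_mul,
    sub_eq_zero, inv_mul_eq_div, div_eq_iff hXa.ne', real_inner_comm] at h2
  rw [h2, mul_comm]

end Dual

/-! ### Faces are nearly exposed -/

lemma isCompact_convexJoin {s t : Set V} (hs : IsCompact s) (ht : IsCompact t) :
    IsCompact (convexJoin ℝ s t) := by
  have h : convexJoin ℝ s t =
      (fun p : ℝ × V × V => AffineMap.lineMap p.2.1 p.2.2 p.1) '' (Icc 0 1 ×ˢ s ×ˢ t) := by
    ext x
    simp only [mem_convexJoin, segment_eq_image_lineMap]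
    constructor
    · rintro ⟨a, ha, b, hb, r, hr, rfl⟩
      exact ⟨(r, a, b), ⟨hr, ha, hb⟩, rfl⟩
    · rintro ⟨⟨r, a, b⟩, ⟨hr, ha, hb⟩, rfl⟩
      exact ⟨a, ha, b, hb, r, hr, rfl⟩
  rw [h]
  refine (isCompact_Icc.prod (hs.prod ht)).image ?_
  simp only [AffineMap.lineMap_apply_module]
  fun_prop

lemma IsFace.convex_sdiff {B F : Set V} (hF : IsFace B F) (hB : Convex ℝ B) :
    Convex ℝ (B \ F) := by
  rw [convex_iff_forall_pos]
  intro x hx y hy s t hs ht hst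
  refine ⟨hB hx.1 hy.1 hs.le ht.le hst, fun hmem => hx.2 ?_⟩
  obtain rfl : t = 1 - s := by linarith
  exact (hF.2.2.2 x hx.1 y hy.1 s hs (by linarith) hmem).1

/-- The complement of a face in a compact convex set is exhausted by compact convex sets. -/
lemma IsFace.exists_isCompact_convex_between {B F S : Set V} (hF : IsFace B F) (hB : Convex ℝ B)
    (hBc : IsCompact B) (hS : IsCompact S) (hSB : S ⊆ B \ F) :
    ∃ K, IsCompact K ∧ Convex ℝ K ∧ S ⊆ K ∧ K ⊆ B \ F := by
  refine hS.induction_on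
    (p := fun s => ∃ K, IsCompact K ∧ Convex ℝ K ∧ s ⊆ K ∧ K ⊆ B \ F)
    ⟨∅, isCompact_empty, convex_empty, Subset.rfl, empty_subset _⟩ ?_ ?_ ?_
  · rintro s t hst ⟨K, h1, h2, h3, h4⟩
    exact ⟨K, h1, h2, hst.trans h3, h4⟩
  · rintro s t ⟨K, h1, h2, h3, h4⟩ ⟨L, k1, k2, k3, k4⟩
    rcases K.eq_empty_or_nonempty with rfl | hK
    · exact ⟨L, k1, k2, union_subset (h3.trans (empty_subset _)) k3, k4⟩
    rcases L.eq_empty_or_nonempty with rfl | hL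
    · exact ⟨K, h1, h2, union_subset h3 (k3.trans (empty_subset _)), h4⟩
    exact ⟨convexJoin ℝ K L, isCompact_convexJoin h1 k1, h2.convexJoin k2,
      union_subset (h3.trans (subset_convexJoin_left hL)) (k3.trans (subset_convexJoin_right hK)),
      convexJoin_subset h4 k4 (hF.convex_sdiff hB)⟩
  · intro x hx
    obtain ⟨r, hr, hrF⟩ := Metric.nhds_basis_closedBall.mem_iff.1
      (hF.2.2.1.isOpen_compl.mem_nhds (hSB hx).2)
    refine ⟨S ∩ Metric.closedBall x r,
      inter_mem_nhdsWithin S (Metric.closedBall_mem_nhds x hr), B ∩ Metric.closedBall x r,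
      hBc.inter_right Metric.isClosed_closedBall, hB.inter (convex_closedBall x r),
      inter_subset_inter_left _ (hSB.trans sdiff_subset), fun v hv => ⟨hv.1, hrF hv.2⟩⟩

/-- Every point `a` of a face `F` of a compact convex set `B` is a limit of points `a'` with a normal
`b` whose exposed face avoids a given compact convex subset of `B \ F`. -/
lemma IsFace.exists_almost_exposing {B F K : Set V} [FiniteDimensional ℝ V] (hF : IsFace B F)
    (hB : Convex ℝ B) (hBc : IsCompact B) (hK : IsCompact K) (hKc : Convex ℝ K) (hKB : K ⊆ B \ F)
    {a : V} (ha : a ∈ F) {ε : ℝ} (hε : 0 < ε) :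
    ∃ a' ∈ B, ∃ b : V, ‖a' - a‖ ≤ ε ∧ (∀ v ∈ B, ⟪b, v⟫ ≤ ⟪b, a'⟫) ∧
      ∀ v ∈ K, ⟪b, v⟫ < ⟪b, a'⟫ := by
  have haB : a ∈ B := hF.1 ha
  obtain ⟨D, hD⟩ := hBc.isBounded.exists_norm_le
  have hD0 : 0 ≤ D := (norm_nonneg a).trans (hD a haB)
  -- `t` exceeds the squared diameter of `B`; `η` keeps the projection within `ε` of `a`
  set t : ℝ := 4 * D ^ 2 + 1 with ht
  have ht0 : 0 < t := by positivity
  set η : ℝ := ε ^ 2 / (2 * t) with hη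
  have hη0 : 0 < η := by positivity
  obtain ⟨b₀, hb1, hb2⟩ : ∃ b₀ : V, (∀ v ∈ B, ⟪b₀, v - a⟫ ≤ η) ∧ ∀ v ∈ K, 1 ≤ ⟪b₀, a - v⟫ := by
    obtain ⟨f, p, q, hp, hpq, hq⟩ := geometric_hahn_banach_compact_closed
      (s := (fun v => η⁻¹ • (v - a)) '' B) (t := (fun v => a - v) '' K)
      (by
        rintro _ ⟨x, hx, rfl⟩ _ ⟨y, hy, rfl⟩ r s hr hs hrs
        refine ⟨r • x + s • y, hB hx hy hr hs hrs, ?_⟩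
        obtain rfl : s = 1 - r := by linarith
        module)
      (hBc.image (by fun_prop))
      (by
        rintro _ ⟨x, hx, rfl⟩ _ ⟨y, hy, rfl⟩ r s hr hs hrs
        refine ⟨r • x + s • y, hKc hx hy hr hs hrs, ?_⟩
        obtain rfl : s = 1 - r := by linarith
        module)
      (hK.image (by fun_prop)).isClosed
      (by
        rw [Set.disjoint_left]
        rintro _ ⟨x, hx, rfl⟩ ⟨y, hy, hxy⟩
        have hxy' : a - y = η⁻¹ • (x - a) := hxy
        have h1 : η • (a - y) = x - a := by
          rw [hxy', smul_smul, mul_inv_cancel₀ hη0.ne', one_smul]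
        have hη1 : 0 < 1 + η := by linarith
        -- `a` is a proper convex combination of `y ∈ K` and `x ∈ B`
        have h2 : (η / (1 + η)) • y + (1 - η / (1 + η)) • x = a := by
          have hx' : x = a + η • (a - y) := by rw [h1]; abel
          rw [hx']
          have e1 : 1 - η / (1 + η) = 1 / (1 + η) := by field_simp; ring
          rw [e1]
          match_scalars
          all_goals
            field_simp
            try ring
        refine (hKB hy).2 (hF.2.2.2 y (hKB hy).1 x hx (η / (1 + η)) (by positivity)
          ((div_lt_one hη1).2 (by linarith)) (by rw [h2]; exact ha)).1)
    have hp0 : 0 < p := by simpa using hp 0 ⟨a, haB, by simp⟩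
    refine ⟨p⁻¹ • (InnerProductSpace.toDual ℝ V).symm f, fun v hv => ?_, fun v hv => ?_⟩
    · have h1 := hp _ ⟨v, hv, rfl⟩
      rw [map_smul, smul_eq_mul, inv_mul_eq_div, div_lt_iff₀ hη0] at h1
      rw [real_inner_smul_left, InnerProductSpace.toDual_symm_apply, inv_mul_eq_div,
        div_le_iff₀ hp0]
      linarith
    · have h1 := hq _ ⟨v, hv, rfl⟩
      rw [real_inner_smul_left, InnerProductSpace.toDual_symm_apply, inv_mul_eq_div,
        le_div_iff₀ hp0]
      linarith
  obtain ⟨a', ha', hmin⟩ := exists_norm_eq_iInf_of_complete_convex ⟨a, haB⟩ hBc.isComplete hB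
    (a + t • b₀)
  have hvar := (norm_eq_iInf_iff_real_inner_le_zero hB ha').1 hmin
  have hexp : ∀ v, ⟪a + t • b₀ - a', v - a'⟫ = ⟪a - a', v - a'⟫ + t * ⟪b₀, v - a'⟫ := by
    intro v
    rw [← real_inner_smul_left, ← inner_add_left]
    congr 1
    abel
  have hclose : ‖a' - a‖ ^ 2 ≤ t * ⟪b₀, a' - a⟫ := by
    have h1 := hvar a haB
    rw [hexp, real_inner_self_eq_norm_sq, ← neg_sub a' a, inner_neg_right, norm_neg] at h1
    linarith
  refine ⟨a', ha', a + t • b₀ - a', ?_, fun v hv => ?_, fun v hv => ?_⟩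
  · have h1 : t * ⟪b₀, a' - a⟫ ≤ t * η := mul_le_mul_of_nonneg_left (hb1 a' ha') ht0.le
    have h2 : t * η = ε ^ 2 / 2 := by rw [hη]; field_simp
    exact abs_le_of_sq_le_sq' (by nlinarith) hε.le |>.2
  · have h1 := hvar v hv
    rw [inner_sub_right] at h1
    linarith
  · have h1 := hexp v
    have h2 : ⟪a - a', v - a'⟫ ≤ 4 * D ^ 2 := by
      refine (real_inner_le_norm _ _).trans ?_
      have e1 : ‖a - a'‖ ≤ 2 * D := by
        have := norm_sub_le a a'; linarith [hD a haB, hD a' ha']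
      have e2 : ‖v - a'‖ ≤ 2 * D := by
        have := norm_sub_le v a'; linarith [hD v (hKB hv).1, hD a' ha']
      calc ‖a - a'‖ * ‖v - a'‖ ≤ (2 * D) * (2 * D) := by gcongr
        _ = 4 * D ^ 2 := by ring
    have h3 : ⟪b₀, v - a'⟫ ≤ -1 := by
      have e1 := hb2 v hv
      have e2 : ⟪b₀, v - a'⟫ = -⟪b₀, a - v⟫ - ⟪b₀, a' - a⟫ := by
        simp only [inner_sub_right]; ring
      have e3 : 0 ≤ ⟪b₀, a' - a⟫ :=
        nonneg_of_mul_nonneg_right ((sq_nonneg _).trans hclose) ht0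
      linarith
    have h4 : t * ⟪b₀, v - a'⟫ ≤ -t := by nlinarith
    rw [inner_sub_right _ v a'] at h1
    linarith

/-! ### Tightness yields unitangent vectors in faces -/

/-- A chord of a set that ends at a relative interior point can be prolonged beyond it. -/
lemma exists_prolongation {F : Set V} {a v : V} (ha : a ∈ intrinsicInterior ℝ F) (hv : v ∈ F) :
    ∃ s : ℝ, 0 < s ∧ a + s • (a - v) ∈ F := by
  obtain ⟨y, hy, rfl⟩ := mem_intrinsicInterior.1 ha
  have hmem : ∀ s : ℝ, (y : V) + s • ((y : V) - v) ∈ affineSpan ℝ F := fun s => by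
    have h := AffineMap.lineMap_mem (-s) y.2 (mem_affineSpan ℝ hv)
    convert h using 1
    rw [AffineMap.lineMap_apply_module']
    module
  let g : ℝ → affineSpan ℝ F := fun s => ⟨(y : V) + s • ((y : V) - v), hmem s⟩
  have hg : Continuous g := Continuous.subtype_mk (by fun_prop) _
  have hg0 : g 0 = y := by ext; simp [g]
  have hev : ∀ᶠ s in 𝓝 (0 : ℝ), g s ∈ ((↑) ⁻¹' F : Set (affineSpan ℝ F)) :=
    hg.continuousAt.eventually_mem (by rw [hg0]; exact mem_interior_iff_mem_nhds.1 hy)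
  obtain ⟨s, hs, hs0⟩ := ((hev.filter_mono nhdsWithin_le_nhds).and
    (self_mem_nhdsWithin (a := (0 : ℝ)) (s := Ioi 0))).exists
  exact ⟨s, hs0, hs⟩

lemma exists_unitangent_of_isTightNorm [FiniteDimensional ℝ V] {X : Seminorm ℝ V}
    (hX : ∀ v : V, X v = 0 → v = 0) (hT : IsTightNorm X) {F : Set V}
    (hF : IsFace (unitBall X) F) (hne : F.Nonempty) :
    ∃ u ∈ F, IsUnitangent X u ∧ PerpTo u F := by
  by_cases h0F : (0 : V) ∈ F
  · exact ⟨0, h0F, by simp [IsUnitangent], fun v _ w _ => by simp⟩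
  have hB := convex_unitBall X
  have hBc := isCompact_unitBall X hX
  obtain ⟨a, ha⟩ := hne.intrinsicInterior hF.2.1
  have haF : a ∈ F := intrinsicInterior_subset ha
  have step : ∀ n : ℕ, ∃ a' w : V, ‖a' - a‖ ≤ 1 / ((n : ℝ) + 1) ∧ X w = 1 ∧
      Metric.infDist w F < 1 / ((n : ℝ) + 1) ∧ ∀ v ∈ unitBall X, ⟪w, v⟫ ≤ ⟪w, a'⟫ := by
    intro n
    have hε : (0 : ℝ) < 1 / ((n : ℝ) + 1) := by positivity
    -- including `0` in the avoided set forces the normal vector `b` below to be nonzero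
    obtain ⟨K, hKc, hKconv, hSK, hKB⟩ := hF.exists_isCompact_convex_between hB hBc
      (S := insert 0 (unitBall X ∩ {v | 1 / ((n : ℝ) + 1) ≤ Metric.infDist v F}))
      ((hBc.inter_right
        (isClosed_le continuous_const (Metric.continuous_infDist_pt F))).insert 0)
      (by
        refine insert_subset ⟨zero_mem_unitBall X, h0F⟩ fun v hv => ⟨hv.1, fun hvF => ?_⟩
        have h1 : 1 / ((n : ℝ) + 1) ≤ Metric.infDist v F := hv.2
        rw [Metric.infDist_zero_of_mem hvF] at h1
        linarith)
    obtain ⟨a', ha'B, b, hclose, hmax, hlt⟩ :=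
      hF.exists_almost_exposing hB hBc hKc hKconv hKB haF hε
    have hpos : 0 < ⟪b, a'⟫ := by simpa using hlt 0 (hSK (mem_insert _ _))
    have hb : b ≠ 0 := by rintro rfl; simp at hpos
    have ha'0 : a' ≠ 0 := by rintro rfl; simp at hpos
    have hXa' : X a' = 1 := by
      have h1 := seminorm_pos hX ha'0
      have h2 := hmax _ (seminorm_normalize h1).le
      rw [real_inner_smul_right, inv_mul_eq_div, div_le_iff₀ h1] at h2
      exact le_antisymm ha'B (le_of_mul_le_mul_left (by linarith) hpos)
    have hdec := hT _ a' b (isDecomposition_of_inner_le fun v hv => hmax v (by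
      rw [hXa'] at hv; exact hv))
    obtain ⟨w, hw1, hwb, hwmax⟩ := exists_multiplier hX hdec hXa' hb
    refine ⟨a', w, hclose, hw1, ?_, hwmax⟩
    by_contra! hcon
    have h1 := hlt w (hSK (mem_insert_of_mem _ ⟨hw1.le, hcon⟩))
    have h2 := inner_le_dualNorm hX b ha'B
    linarith
  choose a' w hclose hw1 hwF hwmax using step
  obtain ⟨u, -, φ, hφ, hlim⟩ := hBc.tendsto_subseq (x := w) fun n => (hw1 n).le
  have hε : Tendsto (fun n => 1 / (((φ n : ℕ) : ℝ) + 1)) atTop (𝓝 0) :=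
    tendsto_one_div_add_atTop_nhds_zero_nat.comp hφ.tendsto_atTop
  have hlima : Tendsto (fun n => a' (φ n)) atTop (𝓝 a) := by
    rw [tendsto_iff_norm_sub_tendsto_zero]
    exact squeeze_zero (fun n => norm_nonneg _) (fun n => hclose (φ n)) hε
  have huF : u ∈ F := by
    rw [hF.2.2.1.mem_iff_infDist_zero hne]
    refine le_antisymm (le_of_tendsto_of_tendsto
      (((Metric.continuous_infDist_pt F).tendsto u).comp hlim) hε
      (Eventually.of_forall fun n => (hwF (φ n)).le)) Metric.infDist_nonneg
  have hXu : X u = 1 :=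
    tendsto_nhds_unique (((continuous_seminorm X).tendsto u).comp hlim)
      (by simp [Function.comp_def, hw1])
  have humax : ∀ v ∈ unitBall X, ⟪u, v⟫ ≤ ⟪u, a⟫ := fun v hv =>
    le_of_tendsto_of_tendsto (hlim.inner tendsto_const_nhds) (hlim.inner hlima)
      (Eventually.of_forall fun n => hwmax (φ n) v hv)
  have hconst : ∀ v ∈ F, ⟪u, v⟫ = ⟪u, a⟫ := by
    intro v hv
    obtain ⟨s, hs, hmem⟩ := exists_prolongation ha hv
    have h1 := humax _ (hF.1 hmem)
    rw [inner_add_right, real_inner_smul_right, inner_sub_right] at h1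
    have h2 : ⟪u, a⟫ - ⟪u, v⟫ ≤ 0 := by
      by_contra! hcon
      nlinarith [mul_pos hs hcon]
    exact le_antisymm (humax v (hF.1 hv)) (by linarith)
  refine ⟨u, huF, ?_, fun v hv z hz => by rw [inner_sub_right, hconst v hv, hconst z hz, sub_self]⟩
  have h1 : dualNorm X u ≤ ⟪u, a⟫ :=
    dualNorm_le (by simpa using humax 0 (zero_mem_unitBall X)) humax
  have h2 := inner_le_dualNorm hX u (hF.1 haF)
  rw [IsUnitangent, hXu, one_mul, ← real_inner_self_eq_norm_sq, hconst u huF]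
  exact le_antisymm h2 h1

end TightNorm

theorem proposition5p10 {V : Type*} [NormedAddCommGroup V] [InnerProductSpace ℝ V]
    [FiniteDimensional ℝ V] (X : Seminorm ℝ V) (hX : ∀ v : V, X v = 0 → v = 0) :
    TightNorm.IsTightNorm X ↔
      ∀ F : Set V, TightNorm.IsFace (TightNorm.unitBall X) F → F.Nonempty →
        ∃ u ∈ F, TightNorm.IsUnitangent X u ∧ TightNorm.PerpTo u F :=
  ⟨fun hT _ hF hne => TightNorm.exists_unitangent_of_isTightNorm hX hT hF hne,
    TightNorm.isTight_of_faces hX⟩
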